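/- Let $X$ be a complex manifold (finite-dimensional, Hausdorff, second countable), and let $\Omega\subsetneq X$ be a domain, i.e. a non-empty connected open subset, with Kobayashi pseudodistance $\mathsf{k}_\Omega$. Write $\overline\Omega$ and $\partial\Omega$ for its closure and boundary in $X$. Fix an exhaustion $(K_j)_{j}$ of $\overline\Omega$ by compact sets with $K_j\subset \mathrm{int}(K_{j+1})$. An end of $\overline\Omega$ is a sequence $e=(F_j)_j$ such that $F_j$ is a connected component of $\overline\Omega\setminus K_j$ and $F_{j+1}\subset F_j$ for all $j$. The end compactification $\overline\Omega^{\mathrm{End}}$ is the disjoint union of $\overline\Omega$ and the set of its ends, with the following topology: a set $U$ is open if $U\cap\overline\Omega$ is open in $\overline\Omega$ and if for every end $e=(F_j)_j$ in $U$ there is a $j$ such that $U$ contains $F_j$ and all ends $(G_\nu)_\nu$ with $G_\nu=F_\nu$ for $\nu\le j$. Put $\partial\overline\Omega^{\mathrm{End}}:=\overline\Omega^{\mathrm{End}}\setminus\Omega$. For $p\in\Omega$, $x\in\partial\overline\Omega^{\mathrm{End}}$ and $R>0$ the big horosphere is $$H^b_p(x,R):=\Big\{z\in\Omega:\ \liminf_{w\to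 x}\big(\mathsf{k}_\Omega(z,w)-\mathsf{k}_\Omega(p,w)\big)<\tfrac12\log R\Big\},$$ where $w$ tends to $x$ within $\Omega$ in the topology of $\overline\Omega^{\mathrm{End}}$. Assume that $\overline\Omega^{\mathrm{End}}$ is sequentially compact, that $\Omega$ is complete Kobayashi hyperbolic (i.e. $\mathsf{k}_\Omega$ is a distance and $(\Omega,\mathsf{k}_\Omega)$ is a complete metric space), and that $$\lim_{(z,w)\to(x,y)}\mathsf{k}_\Omega(z,w)=\infty\qquad\text{for all } x\neq y\in\partial\Omega .$$ Assume moreover that, for some fixed $p\in\Omega$ and for every $x\in\partial\overline\Omega^{\mathrm{End}}$, the set $$\bigcap_{R>0}\overline{H^b_p(x,R)}\qquad(\text{closures taken in }\overline\Omega^{\mathrm{End}})$$ is a singleton. Then for every holomorphic map $f:\Omega\to\Omega$ one of the following holds: (a) for each $z\in\Omega$ the orbit $\{f^n(z):n\in\mathbb{N}\}$ is relatively compact in $\Omega$; (b) there is a point $y\in\partial\overline\Omega^{\mathrm{End}}$ such that $f^n\to y$ in the compact-open topology, as maps from $\Omega$ to $\overline\Omega^{\mathrm{End}}$. -/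

import Mathlib

open Set Filter Topology TopologicalSpace
open scoped Manifold ContDiff ComplexConjugate

/-! ### The Kobayashi distance -/

/-- The Poincaré distance of the unit disc (curvature `-4`):
`artanh |(ζ - η) / (1 - conj ζ * η)| = (1/2) log ((1 + ρ) / (1 - ρ))`. -/
noncomputable def poincareDist (ζ η : ℂ) : ℝ :=
  Real.artanh ‖(ζ - η) / (1 - conj ζ * η)‖

/-- `DiscChain E z w L`: the points `z`, `w` of the complex manifold `M` are joined by a finite
chain of holomorphic discs whose Poincaré lengths add up to `L`. -/
inductive DiscChain (E : Type*) [NormedAddCommGroup E] [NormedSpace ℂ E]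
    {M : Type*} [TopologicalSpace M] [ChartedSpace E M] : M → M → ℝ → Prop
  | nil (z : M) : DiscChain E z z 0
  | cons (φ : ℂ → M) (hφ : MDifferentiableOn 𝓘(ℂ) 𝓘(ℂ, E) φ (Metric.ball 0 1))
      (ζ η : ℂ) (hζ : ζ ∈ Metric.ball (0 : ℂ) 1) (hη : η ∈ Metric.ball (0 : ℂ) 1)
      (w : M) (L : ℝ) (h : DiscChain E (φ η) w L) :
      DiscChain E (φ ζ) w (poincareDist ζ η + L)

/-- The Kobayashi pseudodistance of a connected complex manifold `M` modelled on `E`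
(any two points of a connected manifold are joined by a chain of discs). -/
noncomputable def kobayashiDist (E : Type*) [NormedAddCommGroup E] [NormedSpace ℂ E]
    {M : Type*} [TopologicalSpace M] [ChartedSpace E M] (z w : M) : ℝ :=
  sInf {L : ℝ | DiscChain E z w L}

/-- `M` is Kobayashi hyperbolic: the Kobayashi pseudodistance separates points. -/
def KobayashiHyperbolic (E : Type*) [NormedAddCommGroup E] [NormedSpace ℂ E]
    (M : Type*) [TopologicalSpace M] [ChartedSpace E M] : Prop :=
  ∀ z w : M, kobayashiDist E z w = 0 → z = w

/-- Every Cauchy sequence for the Kobayashi distance converges for the Kobayashi distance. -/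
def KobayashiComplete (E : Type*) [NormedAddCommGroup E] [NormedSpace ℂ E]
    (M : Type*) [TopologicalSpace M] [ChartedSpace E M] : Prop :=
  ∀ u : ℕ → M,
    (∀ ε > 0, ∃ N, ∀ m ≥ N, ∀ n ≥ N, kobayashiDist E (u m) (u n) < ε) →
    ∃ z : M, Tendsto (fun n => kobayashiDist E (u n) z) atTop (𝓝 0)

/-! ### The end compactification -/

/-- An end of `Y`, relative to a compact exhaustion `K`: a decreasing sequence whose `j`-th term
is a connected component of `Y \ K j`. -/
structure SpaceEnd {Y : Type*} [TopologicalSpace Y] (K : CompactExhaustion Y) where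
  /-- the sequence of components -/
  comp : ℕ → Set Y
  isComponent : ∀ j, ∃ y ∈ (K j)ᶜ, comp j = connectedComponentIn (K j)ᶜ y
  succ_subset : ∀ j, comp (j + 1) ⊆ comp j

/-- The end compactification: the disjoint union of `Y` and its set of ends. -/
inductive EndCompactification {Y : Type*} [TopologicalSpace Y] (K : CompactExhaustion Y)
  | ofPoint (y : Y) : EndCompactification K
  | ofEnd (e : SpaceEnd K) : EndCompactification K

namespace EndCompactification

/-- The `j`-th basic neighbourhood of the end `e`: the component `e.comp j` together with all ends
whose components agree with those of `e` up to the index `j`. -/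
def basicNhd {Y : Type*} [TopologicalSpace Y] {K : CompactExhaustion Y} (e : SpaceEnd K) (j : ℕ) :
    Set (EndCompactification K) :=
  ofPoint '' e.comp j ∪ ofEnd '' {g | ∀ i ≤ j, g.comp i = e.comp i}

theorem basicNhd_anti {Y : Type*} [TopologicalSpace Y] {K : CompactExhaustion Y} (e : SpaceEnd K)
    {i j : ℕ} (h : i ≤ j) : basicNhd e j ⊆ basicNhd e i :=
  union_subset_union (image_mono (antitone_nat_of_succ_le e.succ_subset h))
    (image_mono fun _ hg k hk => hg k (hk.trans h))

/-- A set is open if its trace on `Y` is open and it contains a basic neighbourhood of each of its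
ends. -/
instance {Y : Type*} [TopologicalSpace Y] (K : CompactExhaustion Y) :
    TopologicalSpace (EndCompactification K) where
  IsOpen U := IsOpen (ofPoint ⁻¹' U) ∧ ∀ e, ofEnd e ∈ U → ∃ j, basicNhd e j ⊆ U
  isOpen_univ := ⟨isOpen_univ, fun _ _ => ⟨0, subset_univ _⟩⟩
  isOpen_inter := by
    rintro U V ⟨hU, hU'⟩ ⟨hV, hV'⟩
    refine ⟨hU.inter hV, fun e he => ?_⟩
    obtain ⟨i, hi⟩ := hU' e he.1
    obtain ⟨j, hj⟩ := hV' e he.2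
    exact ⟨max i j, subset_inter ((basicNhd_anti e (le_max_left i j)).trans hi)
      ((basicNhd_anti e (le_max_right i j)).trans hj)⟩
  isOpen_sUnion := by
    intro S hS
    refine ⟨?_, fun e he => ?_⟩
    · rw [preimage_sUnion]
      exact isOpen_biUnion fun U hU => (hS U hU).1
    · obtain ⟨U, hU, heU⟩ := he
      obtain ⟨j, hj⟩ := (hS U hU).2 e heU
      exact ⟨j, hj.trans (subset_sUnion_of_mem hU)⟩

theorem continuous_ofPoint {Y : Type*} [TopologicalSpace Y] (K : CompactExhaustion Y) :
    Continuous (ofPoint : Y → EndCompactification K) :=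
  ⟨fun _ hU => hU.1⟩

end EndCompactification

/-- The inclusion of a domain `Ω` in the end compactification of its closure. -/
def endInclusion {X : Type*} [TopologicalSpace X] (Ω : Opens X)
    (K : CompactExhaustion (closure (Ω : Set X))) : C(Ω, EndCompactification K) where
  toFun z := .ofPoint ⟨z, subset_closure z.2⟩
  continuous_toFun := (EndCompactification.continuous_ofPoint K).comp (by fun_prop)

/-- The boundary of `Ω` in the end compactification of its closure. -/
def endBoundary {X : Type*} [TopologicalSpace X] (Ω : Opens X)
    (K : CompactExhaustion (closure (Ω : Set X))) : Set (EndCompactification K) :=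
  (range (endInclusion Ω K))ᶜ

/-! ### Boundary divergence and big horospheres -/

/-- `k_Ω(z, w) → ∞` as `(z, w) → (x, y)`, for all pairs of distinct points `x`, `y` of the
boundary of `Ω` in `X`. -/
def BoundaryDivergence (E : Type*) [NormedAddCommGroup E] [NormedSpace ℂ E]
    {X : Type*} [TopologicalSpace X] [ChartedSpace E X] (Ω : Opens X) : Prop :=
  ∀ x ∈ frontier (Ω : Set X), ∀ y ∈ frontier (Ω : Set X), x ≠ y →
    Tendsto (fun q : Ω × Ω => kobayashiDist E q.1 q.2)
      (comap Subtype.val (𝓝 x) ×ˢ comap Subtype.val (𝓝 y)) atTop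

/-- The big horosphere with pole `p`, centre `x` and radius `R`: the set of all `z ∈ Ω` with
`liminf_{w → x} (k_Ω(z, w) - k_Ω(p, w)) < (1/2) log R`. -/
noncomputable def bigHorosphere (E : Type*) [NormedAddCommGroup E] [NormedSpace ℂ E]
    {X : Type*} [TopologicalSpace X] [ChartedSpace E X] (Ω : Opens X)
    (K : CompactExhaustion (closure (Ω : Set X))) (p : Ω) (x : EndCompactification K) (R : ℝ) :
    Set Ω :=
  {z | liminf (fun w : Ω => ((kobayashiDist E z w - kobayashiDist E p w : ℝ) : EReal))
      (comap (endInclusion Ω K) (𝓝 x)) < ((1 / 2 * Real.log R : ℝ) : EReal)}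

/-! ### Poincaré geometry of the unit disc -/

/-! Disc chains can be cut at any length, so the Kobayashi distance k is a length distance. By
Barth's theorem it induces the manifold topology, and by Hopf–Rinow its closed balls are compact.
Holomorphic self-maps do not increase k. By Całka's theorem (`isBounded_orbit_of_frequently`), the
orbit of p is therefore either bounded, which gives (a), or k(p, fⁿp) → ∞.

In the second case, choose times at which k(p, fⁿp) sets a record, along which fⁿp tends to some
boundary point x. From any orbit point, move a fixed distance r towards such a far iterate: the
record property makes the limit of these points lie in the big horosphere at x, with r depending
only on its radius (`exists_mem_bigHorosphere_of_orbit`).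

Boundary divergence gives shadowing (`tendsto_endBoundary_of_kobayashiDist_le`): sequences a bounded
distance apart have the same boundary limits. So every limit of the orbit lies in the closure of
every big horosphere at x, and hence is the single point y of their intersection. Shadowing again
carries fⁿp → y to all starting points in a compact set. -/

theorem Real.artanh_sub_artanh {s t : ℝ} (hs : 0 ≤ s) (hst : s ≤ t) (ht : t < 1) :
    Real.artanh ((t - s) / (1 - s * t)) = Real.artanh t - Real.artanh s := by
  have h1 : 0 < 1 - s * t := by nlinarith
  have hx0 : 0 ≤ (t - s) / (1 - s * t) := div_nonneg (by linarith) h1.le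
  have hx1 : (t - s) / (1 - s * t) < 1 := by
    rw [div_lt_one h1]; nlinarith
  rw [Real.artanh_eq_half_log ⟨by linarith, hx1.le⟩,
    Real.artanh_eq_half_log ⟨by linarith, ht.le⟩,
    Real.artanh_eq_half_log ⟨by linarith, by linarith⟩, ← mul_sub, ← Real.log_div]
  · congr 2
    have h2 : 1 - t ≠ 0 := by linarith
    have h3 : 1 - s ≠ 0 := by linarith
    have h4 : 1 + s ≠ 0 := by linarith
    have h5 : 1 - (t - s) / (1 - s * t) ≠ 0 := by linarith
    have h7 : (t - s) / (1 - s * t) * (1 - s * t) = t - s := div_mul_cancel₀ _ h1.ne'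
    generalize (t - s) / (1 - s * t) = x at h5 h7
    rw [div_eq_div_iff h5 (div_ne_zero h4 h3)]
    field_simp
    linear_combination 2 * h7
  · exact (div_pos (by linarith) (by linarith)).ne'
  · exact (div_pos (by linarith) (by linarith)).ne'

theorem Real.exists_artanh_eq {r : ℝ} (hr : 0 ≤ r) : ∃ t, 0 ≤ t ∧ t < 1 ∧ Real.artanh t = r := by
  refine ⟨Real.tanh r, ?_, Real.tanh_lt_one r, Real.artanh_tanh r⟩
  by_contra! h
  have := Real.artanh_neg ⟨Real.neg_one_lt_tanh r, h⟩
  rw [Real.artanh_tanh] at this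
  linarith

/-- Follows from |1 + āb|² − |a + b|² = (1 − |a|²)(1 − |b|²). -/
theorem Complex.norm_mobius_lt_one {a b : ℂ} (ha : ‖a‖ < 1) (hb : ‖b‖ < 1) :
    1 + conj a * b ≠ 0 ∧ ‖(a + b) / (1 + conj a * b)‖ < 1 := by
  have hab : ‖conj a * b‖ < 1 := by
    rw [norm_mul, RCLike.norm_conj]
    nlinarith [norm_nonneg a, norm_nonneg b]
  have hne : 1 + conj a * b ≠ 0 := by
    intro h
    have : conj a * b = -1 := by linear_combination h
    rw [this] at hab
    simp at hab
  refine ⟨hne, ?_⟩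
  rw [norm_div, div_lt_one (norm_pos_iff.2 hne)]
  have ha' : ‖a‖ ^ 2 < 1 := by nlinarith [norm_nonneg a]
  have hb' : ‖b‖ ^ 2 < 1 := by nlinarith [norm_nonneg b]
  refine lt_of_pow_lt_pow_left₀ 2 (norm_nonneg _) ?_
  rw [← Complex.normSq_eq_norm_sq] at *
  rw [← Complex.normSq_eq_norm_sq] at *
  rw [Complex.normSq_apply] at *
  rw [Complex.normSq_apply] at *
  simp only [Complex.add_re, Complex.add_im, Complex.one_re, Complex.one_im, Complex.mul_re,
    Complex.mul_im, Complex.conj_re, Complex.conj_im] at *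
  nlinarith [mul_pos (sub_pos.2 ha') (sub_pos.2 hb')]

theorem poincareDist_nonneg (ζ η : ℂ) : 0 ≤ poincareDist ζ η :=
  Real.artanh_nonneg (norm_nonneg _)

theorem poincareDist_comm (ζ η : ℂ) : poincareDist ζ η = poincareDist η ζ := by
  unfold poincareDist
  congr 1
  rw [norm_div, norm_div, norm_sub_rev]
  congr 1
  rw [← RCLike.norm_conj]
  simp [mul_comm]

/-- Along the radius, `artanh` is the arc length parameter; this additivity is what allows a disc to
be cut at a prescribed length. -/
theorem poincareDist_ofReal {s t : ℝ} (hs : 0 ≤ s) (hst : s ≤ t) (ht : t < 1) :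
    poincareDist s t = Real.artanh t - Real.artanh s := by
  rw [← Real.artanh_sub_artanh hs hst ht]
  unfold poincareDist
  congr 1
  have h1 : 0 < 1 - s * t := by nlinarith
  rw [Complex.conj_ofReal, norm_div, norm_sub_rev]
  norm_cast
  rw [Real.norm_of_nonneg (by linarith), Real.norm_of_nonneg h1.le]

/-! ### Chains of holomorphic discs -/

section Chains

variable {E : Type*} [NormedAddCommGroup E] [NormedSpace ℂ E]
  {M : Type*} [TopologicalSpace M] [ChartedSpace E M]

/-- Up to an automorphism of the disc, two points of a holomorphic disc are the images of `0` and
of a point of `[0, 1)`. -/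
theorem exists_normalized_disc {φ : ℂ → M}
    (hφ : MDifferentiableOn 𝓘(ℂ) 𝓘(ℂ, E) φ (Metric.ball 0 1)) {ζ η : ℂ}
    (hζ : ζ ∈ Metric.ball (0 : ℂ) 1) (hη : η ∈ Metric.ball (0 : ℂ) 1) :
    ∃ ψ : ℂ → M, MDifferentiableOn 𝓘(ℂ) 𝓘(ℂ, E) ψ (Metric.ball 0 1) ∧
      ∃ t : ℝ, 0 ≤ t ∧ t < 1 ∧ ψ 0 = φ ζ ∧ ψ t = φ η ∧ poincareDist ζ η = Real.artanh t := by
  rw [mem_ball_zero_iff] at hζ hη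
  set c : ℂ := (η - ζ) / (1 - conj ζ * η) with hc
  obtain ⟨hne, hc1⟩ : 1 - conj ζ * η ≠ 0 ∧ ‖c‖ < 1 := by
    have := Complex.norm_mobius_lt_one (a := -ζ) (b := η) (by simpa using hζ) hη
    have e1 : 1 + conj (-ζ) * η = 1 - conj ζ * η := by simp [sub_eq_add_neg]
    have e2 : -ζ + η = η - ζ := by ring
    rwa [e1, e2] at this
  -- The rotation u places c on the positive radius, so that ξ ↦ (ζ + uξ)/(1 + ζ̄uξ) sends 0 to ζ
  -- and ‖c‖ to η.
  obtain ⟨u, hu, hcu⟩ : ∃ u : ℂ, ‖u‖ = 1 ∧ u * (‖c‖ : ℂ) = c := by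
    by_cases h : c = 0
    · exact ⟨1, by simp, by simp [h]⟩
    · have : (‖c‖ : ℂ) ≠ 0 := by simpa using h
      refine ⟨c / ‖c‖, ?_, by field_simp⟩
      rw [norm_div, Complex.norm_real, norm_norm, div_self (norm_ne_zero_iff.2 h)]
  have hmaps : ∀ ξ ∈ Metric.ball (0 : ℂ) 1, 1 + conj ζ * (u * ξ) ≠ 0 ∧
      (ζ + u * ξ) / (1 + conj ζ * (u * ξ)) ∈ Metric.ball (0 : ℂ) 1 := by
    intro ξ hξ
    rw [mem_ball_zero_iff] at hξ ⊢
    exact Complex.norm_mobius_lt_one hζ (by simpa [hu] using hξ)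
  refine ⟨fun ξ => φ ((ζ + u * ξ) / (1 + conj ζ * (u * ξ))), ?_, ‖c‖, norm_nonneg _, hc1, by simp,
    ?_, ?_⟩
  · refine hφ.comp (f := fun ξ : ℂ => (ζ + u * ξ) / (1 + conj ζ * (u * ξ))) ?_
      fun ξ hξ => (hmaps ξ hξ).2
    rw [mdifferentiableOn_iff_differentiableOn]
    exact DifferentiableOn.div (by fun_prop) (by fun_prop) fun ξ hξ => (hmaps ξ hξ).1
  · have h1 : 1 + conj ζ * c ≠ 0 := (Complex.norm_mobius_lt_one hζ hc1).1
    simp only [hcu]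
    congr 1
    have h2 : c * (1 - conj ζ * η) = η - ζ := div_mul_cancel₀ _ hne
    rw [div_eq_iff h1]
    linear_combination h2
  · rw [poincareDist, hc, norm_div, norm_div, norm_sub_rev]

theorem DiscChain.single {φ : ℂ → M}
    (hφ : MDifferentiableOn 𝓘(ℂ) 𝓘(ℂ, E) φ (Metric.ball 0 1)) {s t : ℝ} (hs : 0 ≤ s)
    (hst : s ≤ t) (ht : t < 1) :
    DiscChain E (φ s) (φ t) (Real.artanh t - Real.artanh s) := by
  have := DiscChain.cons φ hφ s t (by simp [abs_of_nonneg hs]; linarith)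
    (by simp [abs_of_nonneg (hs.trans hst)]; linarith) (φ t) 0 (.nil _)
  rwa [add_zero, poincareDist_ofReal hs hst ht] at this

theorem DiscChain.trans {x y z : M} {L L' : ℝ} (h : DiscChain E x y L) (h' : DiscChain E y z L') :
    DiscChain E x z (L + L') := by
  induction h with
  | nil => simpa using h'
  | cons φ hφ ζ η hζ hη w L h ih =>
    rw [add_assoc]
    exact .cons φ hφ ζ η hζ hη _ _ (ih h')

theorem DiscChain.symm {x y : M} {L : ℝ} (h : DiscChain E x y L) : DiscChain E y x L := by
  induction h with
  | nil => exact .nil _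
  | cons φ hφ ζ η hζ hη w L h ih =>
    have h1 := DiscChain.cons φ hφ η ζ hη hζ _ 0 (.nil _)
    rw [add_zero, poincareDist_comm] at h1
    rw [add_comm]
    exact ih.trans h1

theorem DiscChain.nonneg {x y : M} {L : ℝ} (h : DiscChain E x y L) : 0 ≤ L := by
  induction h with
  | nil => exact le_rfl
  | cons φ hφ ζ η hζ hη w L h ih => exact add_nonneg (poincareDist_nonneg _ _) ih

theorem DiscChain.map {F : Type*} [NormedAddCommGroup F] [NormedSpace ℂ F]
    {N : Type*} [TopologicalSpace N] [ChartedSpace F N] {f : M → N}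
    (hf : MDifferentiable 𝓘(ℂ, E) 𝓘(ℂ, F) f) {x y : M} {L : ℝ} (h : DiscChain E x y L) :
    DiscChain F (f x) (f y) L := by
  induction h with
  | nil => exact .nil _
  | cons φ hφ ζ η hζ hη w L h ih =>
    exact .cons (f ∘ φ) (hf.comp_mdifferentiableOn hφ) ζ η hζ hη _ _ ih

/-- A chain of discs can be cut at any length. -/
theorem DiscChain.split {x y : M} {L : ℝ} (h : DiscChain E x y L) {r : ℝ} (hr : 0 ≤ r)
    (hrL : r ≤ L) : ∃ v, DiscChain E x v r ∧ DiscChain E v y (L - r) := by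
  induction h generalizing r with
  | nil z =>
    obtain rfl : r = 0 := le_antisymm hrL hr
    exact ⟨z, .nil _, by simpa using .nil z⟩
  | cons φ hφ ζ η hζ hη w L h ih =>
    obtain ⟨ψ, hψ, t, ht0, ht1, h0, h1, hd⟩ := exists_normalized_disc hφ hζ hη
    rw [← h0]
    rw [← h1] at h
    rw [hd] at hrL ⊢
    -- The cut falls either on the first disc, at the parameter s with artanh s = r, or on the rest
    -- of the chain.
    rcases le_total r (Real.artanh t) with hrt | hrt
    · obtain ⟨s, hs0, hs1, rfl⟩ := Real.exists_artanh_eq hr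
      have hst : s ≤ t :=
        (Real.artanh_le_artanh_iff ⟨by linarith, hs1⟩ ⟨by linarith, ht1⟩).1 hrt
      refine ⟨ψ s, ?_, ?_⟩
      · simpa using DiscChain.single hψ le_rfl hs0 hs1
      · convert (DiscChain.single hψ hs0 hst ht1).trans h using 1
        ring
    · obtain ⟨v, hv, hv'⟩ := @ih (r - Real.artanh t) (by linarith) (by linarith)
      rw [← h1] at hv
      refine ⟨v, ?_, ?_⟩
      · have := (DiscChain.single hψ le_rfl ht0 ht1).trans hv
        simpa using this
      · convert hv' using 1
        ring

/-- A chain of discs of length `L` is carried by a connected set, all of whose points are reached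
by chains of length at most `L`. -/
theorem DiscChain.exists_isPreconnected {x y : M} {L : ℝ} (h : DiscChain E x y L) :
    ∃ C : Set M, IsPreconnected C ∧ x ∈ C ∧ y ∈ C ∧ ∀ v ∈ C, ∃ L' ≤ L, DiscChain E x v L' := by
  induction h with
  | nil z => exact ⟨{z}, isPreconnected_singleton, rfl, rfl, fun v hv => ⟨0, le_rfl, by
      rw [mem_singleton_iff.1 hv]; exact .nil z⟩⟩
  | cons φ hφ ζ η hζ hη w L h ih =>
    obtain ⟨ψ, hψ, t, ht0, ht1, h0, h1, hd⟩ := exists_normalized_disc hφ hζ hη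
    obtain ⟨C, hC, hηC, hwC, hCL⟩ := ih
    rw [← h0, hd]
    rw [← h1] at hηC hCL
    have hL := h.nonneg
    have ht : (t : ℝ) ∈ Icc 0 t := ⟨ht0, le_rfl⟩
    have hcont : ContinuousOn (fun s : ℝ => ψ s) (Icc 0 t) := by
      refine hψ.continuousOn.comp Complex.continuous_ofReal.continuousOn fun s hs => ?_
      simp only [mem_ball_zero_iff, Complex.norm_real, Real.norm_eq_abs, abs_of_nonneg hs.1]
      exact hs.2.trans_lt ht1
    refine ⟨(fun s : ℝ => ψ s) '' Icc 0 t ∪ C, IsPreconnected.union (ψ t) ⟨t, ht, rfl⟩ hηC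
      (isPreconnected_Icc.image _ hcont) hC, .inl ⟨0, ⟨le_rfl, ht0⟩, by simp⟩, .inr hwC, ?_⟩
    rintro v (⟨s, hs, rfl⟩ | hv)
    · refine ⟨Real.artanh s, ?_, ?_⟩
      · have := Real.artanh_le_artanh (by linarith [hs.1]) ht1 hs.2
        linarith
      · simpa using DiscChain.single hψ le_rfl hs.1 (hs.2.trans_lt ht1)
    · obtain ⟨L', hL', hv⟩ := hCL v hv
      refine ⟨Real.artanh t + L', by linarith, ?_⟩
      simpa using (DiscChain.single hψ le_rfl ht0 ht1).trans hv

/-- Points close to `x` are reached from `x` by short chains. -/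
theorem DiscChain.eventually_short [IsManifold 𝓘(ℂ, E) 1 M] (x : M) {ε : ℝ} (hε : 0 < ε) :
    ∀ᶠ y in 𝓝 x, ∃ L < ε, DiscChain E x y L := by
  obtain ⟨ρ, hρ, hball⟩ := Metric.isOpen_iff.1 (chartAt E x).open_target _ (mem_chart_target E x)
  obtain ⟨t, ht0, ht1, hta⟩ := Real.exists_artanh_eq (half_pos hε).le
  replace ht0 : 0 < t := ht0.lt_of_ne <| by
    rintro rfl
    rw [Real.artanh_zero] at hta
    linarith
  have hnear : ∀ᶠ y in 𝓝 x, chartAt E x y ∈ Metric.ball (chartAt E x x) (t * ρ) :=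
    ((chartAt E x).continuousAt (mem_chart_source E x)).eventually
      (Metric.ball_mem_nhds _ (mul_pos ht0 hρ))
  filter_upwards [hnear, (chartAt E x).open_source.mem_nhds (mem_chart_source E x)] with y hy hys
  -- In the chart, the affine disc with direction v reaches y at the parameter t, where artanh t =
  -- ε/2; it stays in the ball of radius ρ because y is within tρ of the centre.
  set v : E := ((t : ℂ)⁻¹) • (chartAt E x y - chartAt E x x)
  have htc : (t : ℂ) ≠ 0 := by exact_mod_cast ht0.ne'
  have hv : ‖v‖ < ρ := by
    rw [norm_smul, norm_inv, Complex.norm_real, Real.norm_of_nonneg ht0.le, ← dist_eq_norm,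
      inv_mul_lt_iff₀ ht0]
    exact hy
  have hψ : MDifferentiableOn 𝓘(ℂ) 𝓘(ℂ, E)
      (fun ξ : ℂ => (chartAt E x).symm (chartAt E x x + ξ • v)) (Metric.ball 0 1) := by
    refine (mdifferentiableOn_atlas_symm (I := 𝓘(ℂ, E)) (chart_mem_atlas E x)).comp
      (f := fun ξ : ℂ => chartAt E x x + ξ • v) ?_ fun ξ hξ => hball ?_
    · rw [mdifferentiableOn_iff_differentiableOn]
      fun_prop
    · rw [mem_ball_zero_iff] at hξ
      rw [mem_ball_iff_norm, add_sub_cancel_left, norm_smul]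
      nlinarith [norm_nonneg ξ, norm_nonneg v]
  refine ⟨ε / 2, by linarith, ?_⟩
  have := DiscChain.single hψ le_rfl ht0.le ht1
  simpa [v, smul_smul, mul_inv_cancel₀ htc, hta, (chartAt E x).left_inv hys] using this

end Chains

/-- Otherwise the interior of N and the complement of its closure would disconnect C. -/
theorem IsPreconnected.exists_mem_frontier {Y : Type*} [TopologicalSpace Y] {C N : Set Y}
    (hC : IsPreconnected C) {a b : Y} (haC : a ∈ C) (haN : a ∈ N) (hbC : b ∈ C) (hbN : b ∉ N) :
    ∃ c ∈ C, c ∈ frontier N := by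
  by_contra! h
  obtain ⟨c, -, hc, hc'⟩ := hC (interior N) (closure N)ᶜ isOpen_interior isClosed_closure.isOpen_compl
    (fun c hc => by
      by_cases h' : c ∈ interior N
      · exact .inl h'
      · exact .inr fun hcl => h c hc ⟨hcl, h'⟩)
    ⟨a, haC, by_contra fun h' => h a haC ⟨subset_closure haN, h'⟩⟩
    ⟨b, hbC, fun h' => h b hbC ⟨h', fun hb => hbN (interior_subset hb)⟩⟩
  exact hc' (subset_closure (interior_subset hc))

/-! ### Proper length spaces -/

/-- The Hopf–Rinow–Cohn-Vossen theorem: a complete, locally compact length space is proper. -/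
theorem properSpace_of_length {M : Type*} [MetricSpace M] [LocallyCompactSpace M] [CompleteSpace M]
    (hlen : ∀ a b : M, ∀ r, 0 ≤ r → r ≤ dist a b → ∀ ε > 0,
      ∃ v, dist a v ≤ r ∧ dist v b < dist a b - r + ε) : ProperSpace M := by
  refine ⟨fun z r => ?_⟩
  by_contra hr
  -- R, the infimum of the radii of non-compact balls, is contradicted by showing that the ball of
  -- radius R, and then slightly larger ones, are compact.
  set S : Set ℝ := {s | ¬ IsCompact (Metric.closedBall z s)} with hS
  have hbdd : BddBelow S := ⟨0, fun s hs => by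
    by_contra! h
    exact hs (by rw [Metric.closedBall_eq_empty.2 h]; exact isCompact_empty)⟩
  have hlt : ∀ s < sInf S, IsCompact (Metric.closedBall z s) := fun s hs =>
    not_not.1 (notMem_of_lt_csInf hs hbdd)
  set R := sInf S
  have hR0 : 0 ≤ R := le_csInf ⟨r, hr⟩ fun s hs => by
    by_contra! h
    exact hs (by rw [Metric.closedBall_eq_empty.2 h]; exact isCompact_empty)
  have hnear : ∀ s δ, 0 ≤ s → 0 < δ → ∀ w ∈ Metric.closedBall z (s + δ),
      ∃ v ∈ Metric.closedBall z s, dist w v < 2 * δ := by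
    intro s δ hs hδ w hw
    rw [Metric.mem_closedBall, dist_comm] at hw
    by_cases h : dist z w ≤ s
    · exact ⟨w, by rwa [Metric.mem_closedBall, dist_comm], by simpa using hδ⟩
    · obtain ⟨v, hv, hv'⟩ := hlen z w s hs (le_of_not_ge h) δ hδ
      exact ⟨v, by rwa [Metric.mem_closedBall, dist_comm], by rw [dist_comm]; linarith⟩
  have hcomp : IsCompact (Metric.closedBall z R) := by
    refine isCompact_iff_totallyBounded_isComplete.2 ⟨?_, Metric.isClosed_closedBall.isComplete⟩
    rw [Metric.totallyBounded_iff]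
    intro ε hε
    rcases hR0.eq_or_lt with h0 | h0
    · exact ⟨{z}, finite_singleton z, by simp [← h0, hε]⟩
    -- The bound R/2 keeps R − δ nonnegative; ε/4 makes the error 2δ + ε/2 at most ε.
    set δ := min (ε / 4) (R / 2)
    have hδ : 0 < δ := by positivity
    have hδε : δ ≤ ε / 4 := min_le_left _ _
    have hδR : δ ≤ R / 2 := min_le_right _ _
    obtain ⟨t, ht, hcov⟩ := Metric.totallyBounded_iff.1
      (hlt (R - δ) (by linarith)).totallyBounded (ε / 2) (half_pos hε)
    refine ⟨t, ht, fun w hw => ?_⟩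
    obtain ⟨v, hv, hwv⟩ := hnear (R - δ) δ (by linarith) hδ w (by simpa using hw)
    obtain ⟨y, hy, hvy⟩ := mem_iUnion₂.1 (hcov hv)
    refine mem_iUnion₂.2 ⟨y, hy, ?_⟩
    have := dist_triangle w v y
    rw [Metric.mem_ball] at hvy ⊢
    linarith
  obtain ⟨δ, hδ, hδc⟩ := hcomp.exists_isCompact_cthickening
  obtain ⟨s, hs, hsR⟩ := exists_lt_of_csInf_lt (s := S) ⟨r, hr⟩ (show sInf S < R + δ / 2 by
    change R < _; linarith)
  refine hs (hδc.of_isClosed_subset Metric.isClosed_closedBall fun w hw => ?_)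
  obtain ⟨v, hv, hwv⟩ := hnear R (δ / 2) hR0 (half_pos hδ) w
    (Metric.closedBall_subset_closedBall hsR.le hw)
  exact Metric.mem_cthickening_of_dist_le w v δ _ hv (by linarith)

/-- Całka's theorem: if an orbit of a nonexpansive self-map of a proper metric space is bounded
along a subsequence, then it is bounded. -/
theorem isBounded_orbit_of_frequently {M : Type*} [MetricSpace M] [ProperSpace M] {f : M → M}
    (hf : LipschitzWith 1 f) (p : M) {C : ℝ} (hC : ∃ᶠ n : ℕ in atTop, dist p (f^[n] p) ≤ C) :
    ∃ C', ∀ n : ℕ, dist p (f^[n] p) ≤ C' := by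
  have hiter : ∀ n a b, dist (f^[n] a) (f^[n] b) ≤ dist a b := fun n a b => by
    simpa using (hf.iterate n).dist_le_mul a b
  -- Each point of a finite 1-net of these orbit points returns to the C-ball after a positive time
  -- at most B. Nonexpansiveness then brings every orbit point of the (C + 1)-ball back to that ball
  -- after at most B steps.
  set O : Set M := {y | ∃ n, y = f^[n] p ∧ dist p y ≤ C + 1} with hO
  have hOtb : TotallyBounded O :=
    (isCompact_closedBall p (C + 1)).totallyBounded.subset fun y ⟨n, _, hy⟩ => by
      rwa [Metric.mem_closedBall, dist_comm]
  obtain ⟨t, htO, htfin, htcov⟩ := Metric.finite_approx_of_totallyBounded hOtb 1 one_pos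
  have hret : ∀ y ∈ t, ∃ m : ℕ, 1 ≤ m ∧ dist p (f^[m] y) ≤ C := by
    intro y hy
    obtain ⟨n, rfl, -⟩ := htO hy
    obtain ⟨q, hq, hqC⟩ := frequently_atTop.1 hC (n + 1)
    refine ⟨q - n, by omega, ?_⟩
    rwa [← Function.iterate_add_apply, Nat.sub_add_cancel (by omega)]
  choose! m hm1 hmC using hret
  obtain ⟨B, hB⟩ := (htfin.image m).bddAbove
  have hstep : ∀ n, dist p (f^[n] p) ≤ C + 1 →
      ∃ k, 1 ≤ k ∧ k ≤ B ∧ dist p (f^[n + k] p) ≤ C + 1 := by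
    intro n hn
    obtain ⟨y, hy, hny⟩ := mem_iUnion₂.1 (htcov ⟨n, rfl, hn⟩)
    refine ⟨m y, hm1 y hy, hB ⟨y, hy, rfl⟩, ?_⟩
    rw [add_comm, Function.iterate_add_apply]
    have h1 := dist_triangle p (f^[m y] y) (f^[m y] (f^[n] p))
    have h2 := hiter (m y) y (f^[n] p)
    have h3 := hmC y hy
    rw [Metric.mem_ball, dist_comm] at hny
    linarith
  obtain ⟨n₀, -, hn₀⟩ := frequently_atTop.1 hC 0
  have hsynd : ∀ j, ∃ n, n ≤ n₀ + j ∧ n₀ + j ≤ n + B ∧ dist p (f^[n] p) ≤ C + 1 := by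
    intro j
    induction j with
    | zero => exact ⟨n₀, by omega, by omega, by linarith⟩
    | succ j ih =>
      obtain ⟨n, hn1, hn2, hn⟩ := ih
      by_cases h : n₀ + (j + 1) ≤ n + B
      · exact ⟨n, by omega, h, hn⟩
      · obtain ⟨k, hk1, hk2, hk⟩ := hstep n hn
        exact ⟨n + k, by omega, by omega, hk⟩
  have hdrift : ∀ k, dist p (f^[k] p) ≤ k * dist p (f p) := by
    intro k
    induction k with
    | zero => simp
    | succ k ih =>
      rw [Function.iterate_succ_apply]
      have h1 := dist_triangle p (f^[k] p) (f^[k] (f p))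
      have h2 := hiter k p (f p)
      push_cast
      linarith
  have hd : 0 ≤ dist p (f p) := dist_nonneg
  -- Each step adds at most `dist p (f p)`; B + n₀ covers both the times before n₀ and the time
  -- since a recent visit.
  refine ⟨C + 1 + (B + n₀ : ℕ) * dist p (f p), fun n => ?_⟩
  have hC0 : 0 ≤ C := dist_nonneg.trans hn₀
  rcases le_total n n₀ with h | h
  · have h1 : (n : ℝ) ≤ (B + n₀ : ℕ) := by exact_mod_cast (by omega)
    have := mul_le_mul_of_nonneg_right h1 hd
    linarith [hdrift n]
  · obtain ⟨n', h1, h2, h3⟩ := hsynd (n - n₀)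
    have h4 := dist_triangle p (f^[n'] p) (f^[n'] (f^[n - n'] p))
    have h5 := hiter n' p (f^[n - n'] p)
    rw [← Function.iterate_add_apply, Nat.add_sub_cancel' (by omega)] at h4
    rw [← Function.iterate_add_apply, Nat.add_sub_cancel' (by omega)] at h5
    have h6 : ((n - n' : ℕ) : ℝ) ≤ (B + n₀ : ℕ) := by exact_mod_cast (by omega)
    have := mul_le_mul_of_nonneg_right h6 hd
    linarith [hdrift (n - n')]

/-! ### The Kobayashi distance -/

section Kobayashi

variable {E : Type*} [NormedAddCommGroup E] [NormedSpace ℂ E]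
  {M : Type*} [TopologicalSpace M] [ChartedSpace E M]

theorem kobayashiDist_le {z w : M} {L : ℝ} (h : DiscChain E z w L) : kobayashiDist E z w ≤ L :=
  csInf_le ⟨0, fun _ h => h.nonneg⟩ h

variable (E) in
theorem kobayashiDist_nonneg (z w : M) : 0 ≤ kobayashiDist E z w :=
  Real.sInf_nonneg fun _ h => DiscChain.nonneg h

variable (E) in
theorem kobayashiDist_self (z : M) : kobayashiDist E z z = 0 :=
  le_antisymm (kobayashiDist_le (.nil z)) (kobayashiDist_nonneg E z z)

variable (E) in
theorem kobayashiDist_comm (z w : M) : kobayashiDist E z w = kobayashiDist E w z := by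
  unfold kobayashiDist
  congr 1
  ext L
  exact ⟨DiscChain.symm, DiscChain.symm⟩

variable (E) in
-- The set of points reachable from z is open and closed. This keeps the infimum defining k away
-- from the empty set, where it would take the default value 0.
theorem exists_discChain [IsManifold 𝓘(ℂ, E) 1 M] [PreconnectedSpace M] (z w : M) :
    ∃ L, DiscChain E z w L := by
  have : IsClopen {w : M | ∃ L, DiscChain E z w L} := by
    constructor
    · rw [← isOpen_compl_iff, isOpen_iff_mem_nhds]
      intro w hw
      filter_upwards [DiscChain.eventually_short (E := E) w one_pos] with u ⟨L, _, hL⟩ ⟨L', hL'⟩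
      exact hw ⟨_, hL'.trans hL.symm⟩
    · rw [isOpen_iff_mem_nhds]
      rintro w ⟨L', hL'⟩
      filter_upwards [DiscChain.eventually_short (E := E) w one_pos] with u ⟨L, _, hL⟩
      exact ⟨_, hL'.trans hL⟩
  exact (this.eq_univ ⟨z, 0, .nil z⟩ ▸ mem_univ w : w ∈ {w : M | ∃ L, DiscChain E z w L})

theorem eventually_kobayashiDist_lt [IsManifold 𝓘(ℂ, E) 1 M] (z : M) {ε : ℝ} (hε : 0 < ε) :
    ∀ᶠ w in 𝓝 z, kobayashiDist E z w < ε := by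
  filter_upwards [DiscChain.eventually_short (E := E) z hε] with w ⟨L, hL, h⟩
  exact (kobayashiDist_le h).trans_lt hL

variable [IsManifold 𝓘(ℂ, E) 1 M] [PreconnectedSpace M]

theorem exists_discChain_lt {z w : M} {c : ℝ} (h : kobayashiDist E z w < c) :
    ∃ L < c, DiscChain E z w L := by
  obtain ⟨L, hL, hLc⟩ := exists_lt_of_csInf_lt (exists_discChain E z w) h
  exact ⟨L, hLc, hL⟩

variable (E) in
theorem kobayashiDist_triangle (x y z : M) :
    kobayashiDist E x z ≤ kobayashiDist E x y + kobayashiDist E y z := by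
  refine le_of_forall_pos_lt_add fun ε hε => ?_
  obtain ⟨L, hL, h⟩ := exists_discChain_lt (lt_add_of_pos_right (kobayashiDist E x y) (half_pos hε))
  obtain ⟨L', hL', h'⟩ :=
    exists_discChain_lt (lt_add_of_pos_right (kobayashiDist E y z) (half_pos hε))
  linarith [kobayashiDist_le (h.trans h')]

theorem kobayashiDist_map_le {f : M → M} (hf : MDifferentiable 𝓘(ℂ, E) 𝓘(ℂ, E) f) (z w : M) :
    kobayashiDist E (f z) (f w) ≤ kobayashiDist E z w :=
  le_csInf (exists_discChain E z w) fun _ h => kobayashiDist_le (DiscChain.map hf h)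

/-- The Kobayashi distance is a length distance. -/
theorem kobayashiDist_split (z w : M) {r ε : ℝ} (hr : 0 ≤ r) (hrk : r ≤ kobayashiDist E z w)
    (hε : 0 < ε) :
    ∃ v, kobayashiDist E z v ≤ r ∧ kobayashiDist E v w < kobayashiDist E z w - r + ε := by
  obtain ⟨L, hL, h⟩ := exists_discChain_lt (lt_add_of_pos_right (kobayashiDist E z w) hε)
  obtain ⟨v, h1, h2⟩ := h.split hr (hrk.trans (kobayashiDist_le h))
  exact ⟨v, kobayashiDist_le h1, (kobayashiDist_le h2).trans_lt (by linarith)⟩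

theorem exists_isPreconnected_of_kobayashiDist_lt {z w : M} {c : ℝ} (h : kobayashiDist E z w < c) :
    ∃ C : Set M, IsPreconnected C ∧ z ∈ C ∧ w ∈ C ∧ ∀ v ∈ C, kobayashiDist E z v < c := by
  obtain ⟨L, hL, h⟩ := exists_discChain_lt h
  obtain ⟨C, hC, hz, hw, hv⟩ := h.exists_isPreconnected
  refine ⟨C, hC, hz, hw, fun v hvC => ?_⟩
  obtain ⟨L', hL', h'⟩ := hv v hvC
  exact (kobayashiDist_le h').trans_lt (hL'.trans_lt hL)

variable (E) in
theorem continuous_kobayashiDist_right (z : M) : Continuous (kobayashiDist E z : M → ℝ) := by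
  refine continuous_iff_continuousAt.2 fun w => Metric.tendsto_nhds.2 fun ε hε => ?_
  filter_upwards [eventually_kobayashiDist_lt (E := E) w hε] with u hu
  rw [Real.dist_eq, abs_sub_lt_iff]
  have h1 := kobayashiDist_triangle E z w u
  have h2 := kobayashiDist_triangle E z u w
  rw [kobayashiDist_comm E u w] at h2
  constructor <;> linarith

/-- Barth's theorem: on a hyperbolic manifold the Kobayashi distance induces the manifold
topology. -/
theorem KobayashiHyperbolic.isOpen_iff [T2Space M] [LocallyCompactSpace M]
    (hM : KobayashiHyperbolic E M) (s : Set M) :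
    IsOpen s ↔ ∀ x ∈ s, ∃ ε > 0, ∀ y, kobayashiDist E x y < ε → y ∈ s := by
  refine ⟨fun hs x hx => ?_, fun h => isOpen_iff_mem_nhds.2 fun x hx => ?_⟩
  · obtain ⟨N, hN, hxN, hNs⟩ := exists_compact_subset hs hx
    have hfr : IsCompact (frontier N) := hN.of_isClosed_subset isClosed_frontier
      hN.isClosed.frontier_subset
    -- A chain leaving N must cross its frontier, so δ, a lower bound for the distance from x to
    -- this compact set, is a radius that forces the endpoint to stay in N.
    obtain ⟨δ, hδ, hδN⟩ : ∃ δ > 0, ∀ y ∈ frontier N, δ ≤ kobayashiDist E x y := by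
      rcases (frontier N).eq_empty_or_nonempty with h0 | h0
      · exact ⟨1, one_pos, by simp [h0]⟩
      · obtain ⟨c, hc, hmin⟩ := hfr.exists_isMinOn h0
          (continuous_kobayashiDist_right E x).continuousOn
        refine ⟨_, (kobayashiDist_nonneg E x c).lt_of_ne fun h => ?_, fun y hy => hmin hy⟩
        exact hc.2 (hM x c h.symm ▸ hxN)
    refine ⟨δ, hδ, fun y hy => hNs ?_⟩
    by_contra hyN
    obtain ⟨C, hC, hxC, hyC, hCδ⟩ := exists_isPreconnected_of_kobayashiDist_lt hy
    obtain ⟨c, hcC, hcN⟩ := hC.exists_mem_frontier hxC (interior_subset hxN) hyC hyN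
    exact (hCδ c hcC).not_ge (hδN c hcN)
  · obtain ⟨ε, hε, hs⟩ := h x hx
    filter_upwards [eventually_kobayashiDist_lt (E := E) x hε] with y hy using hs y hy

/-- The Kobayashi distance as a metric structure compatible with the manifold topology. -/
noncomputable abbrev KobayashiHyperbolic.metricSpace [T2Space M] [LocallyCompactSpace M]
    (hM : KobayashiHyperbolic E M) : MetricSpace M :=
  .ofDistTopology (kobayashiDist E) (kobayashiDist_self E) (kobayashiDist_comm E)
    (kobayashiDist_triangle E) hM.isOpen_iff hM

theorem KobayashiComplete.properSpace [T2Space M] [LocallyCompactSpace M]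
    (hM : KobayashiHyperbolic E M) (hc : KobayashiComplete E M) :
    letI := hM.metricSpace; ProperSpace M := by
  let := hM.metricSpace
  have : CompleteSpace M := by
    refine UniformSpace.complete_of_cauchySeq_tendsto fun u hu => ?_
    obtain ⟨z, hz⟩ := hc u fun ε hε => Metric.cauchySeq_iff.1 hu ε hε
    exact ⟨z, tendsto_iff_dist_tendsto_zero.2 hz⟩
  exact properSpace_of_length fun a b r hr hrd ε hε => kobayashiDist_split a b hr hrd hε

theorem KobayashiComplete.isCompact_closedBall [T2Space M] [LocallyCompactSpace M]
    (hM : KobayashiHyperbolic E M) (hc : KobayashiComplete E M) (z : M) (r : ℝ) :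
    IsCompact {w | kobayashiDist E z w ≤ r} := by
  let := hM.metricSpace
  have := hc.properSpace hM
  have hball : {w | kobayashiDist E z w ≤ r} = Metric.closedBall z r := by
    ext w
    rw [Metric.mem_closedBall, dist_comm]
    rfl
  rw [hball]
  exact ProperSpace.isCompact_closedBall z r

theorem KobayashiComplete.bounded_orbit [T2Space M] [LocallyCompactSpace M]
    (hM : KobayashiHyperbolic E M) (hc : KobayashiComplete E M) {f : M → M}
    (hf : MDifferentiable 𝓘(ℂ, E) 𝓘(ℂ, E) f) (p : M) {C : ℝ}
    (hC : ∃ᶠ n : ℕ in atTop, kobayashiDist E p (f^[n] p) ≤ C) :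
    ∃ C', ∀ n : ℕ, kobayashiDist E p (f^[n] p) ≤ C' := by
  let := hM.metricSpace
  have := hc.properSpace hM
  refine isBounded_orbit_of_frequently (f := f) (LipschitzWith.of_dist_le_mul fun a b => ?_) p hC
  rw [NNReal.coe_one, one_mul]
  exact kobayashiDist_map_le hf a b

end Kobayashi

/-! ### Convergence in the end compactification -/

namespace EndCompactification

variable {Y : Type*} [TopologicalSpace Y] {K : CompactExhaustion Y}

theorem ofPoint_injective : Function.Injective (ofPoint : Y → EndCompactification K) :=
  fun _ _ h => by injection h

theorem isOpen_image_ofPoint {V : Set Y} (hV : IsOpen V) :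
    IsOpen (ofPoint '' V : Set (EndCompactification K)) := by
  refine ⟨by rwa [preimage_image_eq _ ofPoint_injective], ?_⟩
  rintro e ⟨y, -, hy⟩
  cases hy

/-- Some `K j` contains Q, so the j-th basic neighbourhood of any end misses it. -/
theorem isClosed_image_ofPoint [T2Space Y] {Q : Set Y} (hQ : IsCompact Q) :
    IsClosed (ofPoint '' Q : Set (EndCompactification K)) := by
  rw [← isOpen_compl_iff]
  refine ⟨by rw [preimage_compl, preimage_image_eq _ ofPoint_injective]
             exact hQ.isClosed.isOpen_compl, fun e _ => ?_⟩
  obtain ⟨j, hj⟩ := K.exists_superset_of_isCompact hQ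
  refine ⟨j, ?_⟩
  rintro _ (⟨y, hy, rfl⟩ | ⟨g, -, rfl⟩) ⟨y', hy', h⟩
  · obtain rfl := ofPoint_injective h
    obtain ⟨y₀, -, he⟩ := e.isComponent j
    rw [he] at hy
    exact connectedComponentIn_subset _ _ hy (hj hy')
  · cases h

theorem eventually_notMem_of_tendsto_ofEnd [T2Space Y] {v : ℕ → Y} {e : SpaceEnd K}
    (hv : Tendsto (fun i => (ofPoint (v i) : EndCompactification K)) atTop (𝓝 (ofEnd e)))
    {Q : Set Y} (hQ : IsCompact Q) : ∀ᶠ i in atTop, v i ∉ Q := by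
  filter_upwards [hv.eventually ((isClosed_image_ofPoint hQ).isOpen_compl.mem_nhds
    (by rintro ⟨y, -, hy⟩; cases hy))] with i hi hiQ
  exact hi ⟨_, hiQ, rfl⟩

/-- The components of an end need not be open, but they absorb every sequence converging to the
end: otherwise one could remove the (locally finite) set of terms outside a component from a
neighbourhood of the end. -/
theorem eventually_mem_comp_of_tendsto_ofEnd [T2Space Y] [WeaklyLocallyCompactSpace Y]
    {v : ℕ → Y} {e : SpaceEnd K}
    (hv : Tendsto (fun i => (ofPoint (v i) : EndCompactification K)) atTop (𝓝 (ofEnd e)))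
    (j : ℕ) : ∀ᶠ i in atTop, v i ∈ e.comp j := by
  set S : Set Y := ⋃ i, {y | y = v i ∧ v i ∉ e.comp j} with hS
  have hSclosed : IsClosed S := by
    refine LocallyFinite.isClosed_iUnion (fun y => ?_) fun i => ?_
    · obtain ⟨N, hN, hyN⟩ := exists_compact_mem_nhds y
      refine ⟨N, hyN, ?_⟩
      obtain ⟨n, hn⟩ := eventually_atTop.1 (eventually_notMem_of_tendsto_ofEnd hv hN)
      refine (finite_lt_nat n).subset ?_
      rintro i ⟨_, ⟨rfl, -⟩, hiN⟩
      by_contra h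
      exact hn i (not_lt.1 h) hiN
    · by_cases h : v i ∈ e.comp j
      · simp [h]
      · simp [h]
  set U : Set (EndCompactification K) := ofPoint '' Sᶜ ∪ ofEnd '' {g | ∀ i ≤ j, g.comp i = e.comp i}
    with hU
  have hUopen : IsOpen U := by
    constructor
    · convert hSclosed.isOpen_compl using 1
      ext y
      simp [hU]
    · intro g hg
      have hg : ∀ i ≤ j, g.comp i = e.comp i := by simpa [hU] using hg
      refine ⟨j, ?_⟩
      rintro _ (⟨y, hy, rfl⟩ | ⟨g', hg', rfl⟩)
      · refine .inl ⟨y, fun hyS => ?_, rfl⟩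
        obtain ⟨i, rfl, hi⟩ := mem_iUnion.1 hyS
        exact hi (hg j le_rfl ▸ hy)
      · exact .inr ⟨g', fun i hi => (hg' i hi).trans (hg i hi), rfl⟩
  filter_upwards [hv.eventually (hUopen.mem_nhds (.inr ⟨e, fun _ _ => rfl, rfl⟩))] with i hi
  by_contra h
  rcases hi with ⟨y, hy, hyi⟩ | ⟨g, -, hg⟩
  · obtain rfl := ofPoint_injective hyi
    exact hy (mem_iUnion.2 ⟨i, rfl, h⟩)
  · cases hg

end EndCompactification

/-! ### Boundary divergence and shadowing -/

section Shadowing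

variable {E : Type*} [NormedAddCommGroup E] [NormedSpace ℂ E]
  {X : Type*} [TopologicalSpace X] [ChartedSpace E X]

/-- Boundary divergence made uniform by compactness of A × A': near a pair with a coordinate in Ω,
the set Q absorbs that coordinate; a pair of frontier points is distinct by disjointness, so the
hypothesis applies. -/
theorem BoundaryDivergence.exists_isCompact [LocallyCompactSpace X] {Ω : Opens X}
    (hdiv : BoundaryDivergence E Ω) {A A' : Set (closure (Ω : Set X))} (hA : IsCompact A)
    (hA' : IsCompact A') (hAA' : Disjoint A A') (R : ℝ) :
    ∃ Q : Set Ω, IsCompact Q ∧ ∀ u u' : Ω, inclusion subset_closure u ∈ A →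
      inclusion subset_closure u' ∈ A' → u ∉ Q → u' ∉ Q → R < kobayashiDist E u u' := by
  have hloc : LocallyCompactSpace Ω := Ω.isOpen.locallyCompactSpace
  have hinner : ∀ a : closure (Ω : Set X), (a : X) ∈ Ω → ∃ Q : Set Ω, IsCompact Q ∧
      ∃ V ∈ 𝓝 a, ∀ u : Ω, inclusion subset_closure u ∈ V → u ∈ Q := by
    intro a ha
    obtain ⟨Q, hQ, haQ⟩ := exists_compact_mem_nhds (⟨a, ha⟩ : Ω)
    rw [nhds_subtype_eq_comap] at haQ
    obtain ⟨V, hV, hVQ⟩ := haQ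
    exact ⟨Q, hQ, Subtype.val ⁻¹' V, continuous_subtype_val.continuousAt hV, fun u hu => hVQ hu⟩
  suffices h : ∃ Q : Set Ω, IsCompact Q ∧ ∀ u u' : Ω,
      ((inclusion subset_closure u, inclusion subset_closure u') :
        closure (Ω : Set X) × closure (Ω : Set X)) ∈ A ×ˢ A' →
      u ∉ Q → u' ∉ Q → R < kobayashiDist E u u' by
    obtain ⟨Q, hQ, h⟩ := h
    exact ⟨Q, hQ, fun u u' hu hu' => h u u' ⟨hu, hu'⟩⟩
  refine (hA.prod hA').induction_on (p := fun S => ∃ Q : Set Ω, IsCompact Q ∧ ∀ u u' : Ω,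
      ((inclusion subset_closure u, inclusion subset_closure u') :
        closure (Ω : Set X) × closure (Ω : Set X)) ∈ S →
      u ∉ Q → u' ∉ Q → R < kobayashiDist E u u') ⟨∅, isCompact_empty, by simp⟩ ?_ ?_ ?_
  · rintro S T hST ⟨Q, hQ, h⟩
    exact ⟨Q, hQ, fun u u' hu => h u u' (hST hu)⟩
  · rintro S T ⟨Q, hQ, h⟩ ⟨Q', hQ', h'⟩
    refine ⟨Q ∪ Q', hQ.union hQ', fun u u' hu h1 h2 => ?_⟩
    rw [mem_union, not_or] at h1 h2
    rcases hu with hu | hu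
    · exact h u u' hu h1.1 h2.1
    · exact h' u u' hu h1.2 h2.2
  · rintro ⟨a, a'⟩ ⟨ha, ha'⟩
    by_cases haΩ : (a : X) ∈ Ω
    · obtain ⟨Q, hQ, V, hV, hVQ⟩ := hinner a haΩ
      exact ⟨V ×ˢ univ, mem_nhdsWithin_of_mem_nhds (prod_mem_nhds hV univ_mem), Q, hQ,
        fun u u' hu h1 _ => absurd (hVQ u hu.1) h1⟩
    by_cases haΩ' : (a' : X) ∈ Ω
    · obtain ⟨Q, hQ, V, hV, hVQ⟩ := hinner a' haΩ'
      exact ⟨univ ×ˢ V, mem_nhdsWithin_of_mem_nhds (prod_mem_nhds univ_mem hV), Q, hQ,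
        fun u u' hu _ h2 => absurd (hVQ u' hu.2) h2⟩
    have hne : (a : X) ≠ a' := fun h => hAA'.ne_of_mem ha ha' (Subtype.ext h)
    have hfr : ∀ b : closure (Ω : Set X), (b : X) ∉ Ω → (b : X) ∈ frontier (Ω : Set X) :=
      fun b hb => ⟨b.2, by rwa [Ω.isOpen.interior_eq]⟩
    obtain ⟨W, ⟨V, hV, hVW⟩, W', ⟨V', hV', hVW'⟩, hW⟩ := mem_prod_iff.1
      ((hdiv a (hfr a haΩ) a' (hfr a' haΩ') hne).eventually (eventually_gt_atTop R))
    refine ⟨(Subtype.val ⁻¹' V) ×ˢ (Subtype.val ⁻¹' V'), mem_nhdsWithin_of_mem_nhds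
      (prod_mem_nhds (continuous_subtype_val.continuousAt hV)
        (continuous_subtype_val.continuousAt hV')), ∅, isCompact_empty, fun u u' hu _ _ => ?_⟩
    exact hW (mk_mem_prod (hVW hu.1) (hVW' hu.2))

theorem eventually_notMem_of_tendsto_endBoundary {Ω : Opens X} [T2Space X]
    {K : CompactExhaustion (closure (Ω : Set X))} {y : EndCompactification K}
    (hy : y ∈ endBoundary Ω K) {ι : Type*} {l : Filter ι} {v : ι → Ω}
    (hv : Tendsto (fun i => endInclusion Ω K (v i)) l (𝓝 y)) {Q : Set Ω} (hQ : IsCompact Q) :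
    ∀ᶠ i in l, v i ∉ Q := by
  have hcl := EndCompactification.isClosed_image_ofPoint (K := K)
    (hQ.image (f := inclusion subset_closure) (by fun_prop))
  filter_upwards [hv.eventually (hcl.isOpen_compl.mem_nhds (by
    rintro ⟨_, ⟨z, -, rfl⟩, h⟩
    exact hy ⟨z, h⟩))] with i hi hiQ
  exact hi ⟨_, ⟨_, hiQ, rfl⟩, rfl⟩

theorem mem_endBoundary_of_tendsto [LocallyCompactSpace X] {Ω : Opens X}
    {K : CompactExhaustion (closure (Ω : Set X))} {y : EndCompactification K}
    {ι : Type*} {l : Filter ι} [l.NeBot] {v : ι → Ω}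
    (hv : Tendsto (fun i => endInclusion Ω K (v i)) l (𝓝 y))
    (hleave : ∀ Q : Set Ω, IsCompact Q → ∀ᶠ i in l, v i ∉ Q) : y ∈ endBoundary Ω K := by
  rintro ⟨z, rfl⟩
  have hlocΩ : LocallyCompactSpace Ω := Ω.isOpen.locallyCompactSpace
  obtain ⟨Q, hQ, hzQ⟩ := exists_compact_mem_nhds z
  rw [nhds_subtype_eq_comap] at hzQ
  obtain ⟨V, hV, hVQ⟩ := hzQ
  have hnhd := (EndCompactification.isOpen_image_ofPoint (K := K)
    (isOpen_interior.preimage continuous_subtype_val)).mem_nhds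
    ⟨inclusion subset_closure z, mem_interior_iff_mem_nhds.2 hV, rfl⟩
  obtain ⟨i, ⟨q, hq, hqi⟩, hi⟩ := ((hv.eventually hnhd).and (hleave Q hQ)).exists
  obtain rfl := EndCompactification.ofPoint_injective hqi
  exact hi (hVQ (interior_subset (s := V) hq))

/-- Sequences at bounded Kobayashi distance have the same limits in the boundary of the end
compactification. -/
theorem tendsto_endBoundary_of_kobayashiDist_le [T2Space X] [LocallyCompactSpace X]
    {Ω : Opens X} [IsManifold 𝓘(ℂ, E) 1 Ω] [PreconnectedSpace Ω]
    {K : CompactExhaustion (closure (Ω : Set X))}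
    (hhyp : KobayashiHyperbolic E Ω) (hcomplete : KobayashiComplete E Ω)
    (hdiv : BoundaryDivergence E Ω) {y : EndCompactification K} (hy : y ∈ endBoundary Ω K)
    {v x : ℕ → Ω} (hv : Tendsto (fun i => endInclusion Ω K (v i)) atTop (𝓝 y)) {R : ℝ}
    (hR : ∀ i, kobayashiDist E (v i) (x i) ≤ R) :
    Tendsto (fun i => endInclusion Ω K (x i)) atTop (𝓝 y) := by
  have hlocΩ : LocallyCompactSpace Ω := Ω.isOpen.locallyCompactSpace
  have hlocY : LocallyCompactSpace (closure (Ω : Set X)) :=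
    isClosed_closure.isClosedEmbedding_subtypeVal.locallyCompactSpace
  have hpath : ∀ i, ∃ C : Set Ω, IsPreconnected C ∧ v i ∈ C ∧ x i ∈ C ∧
      ∀ u ∈ C, kobayashiDist E (v i) u < R + 1 := fun i =>
    exists_isPreconnected_of_kobayashiDist_lt ((hR i).trans_lt (lt_add_one R))
  choose C hC hvC hxC hCR using hpath
  set j : Ω → closure (Ω : Set X) := inclusion subset_closure with hj
  have hjcont : Continuous j := by fun_prop
  -- The connected sets `C i` have bounded radius about `v i`, which leaves every closed Kobayashi
  -- ball, so they leave compact sets as a whole.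
  have hleave : ∀ Q : Set Ω, IsCompact Q → ∀ᶠ i in atTop, ∀ u ∈ C i, u ∉ Q := by
    intro Q hQ
    obtain ⟨B, hB⟩ := hQ.bddAbove_image (continuous_kobayashiDist_right E (v 0)).continuousOn
    filter_upwards [eventually_notMem_of_tendsto_endBoundary hy hv
      (hcomplete.isCompact_closedBall hhyp (v 0) (B + (R + 1)))] with i hi u hu huQ
    refine hi ?_
    have h1 := kobayashiDist_triangle E (v 0) u (v i)
    have h2 := hB ⟨u, huQ, rfl⟩
    have h3 := hCR i u hu
    rw [kobayashiDist_comm E u] at h1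
    change kobayashiDist E (v 0) (v i) ≤ _
    linarith
  -- A set `C i` meeting N but not contained in N' would cross both frontiers. The crossing points
  -- are within R + 1 of `v i`, hence less than 2(R + 1) apart, contradicting divergence.
  have hcross : ∀ N N' : Set (closure (Ω : Set X)), IsCompact N → IsCompact N' →
      N ⊆ interior N' → ∀ᶠ i in atTop, ∀ u ∈ C i, ∀ u' ∈ C i, j u ∈ N → j u' ∈ N' := by
    intro N N' hN hN' hNN'
    have hd : Disjoint (frontier N) (frontier N') :=
      (disjoint_interior_frontier (s := N')).mono_left
        (hN.isClosed.frontier_subset.trans hNN')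
    obtain ⟨Q, hQ, hQR⟩ := hdiv.exists_isCompact
      (hN.of_isClosed_subset isClosed_frontier hN.isClosed.frontier_subset)
      (hN'.of_isClosed_subset isClosed_frontier hN'.isClosed.frontier_subset) hd (2 * (R + 1))
    filter_upwards [hleave Q hQ] with i hi u hu u' hu' huN
    by_contra hu'N
    have hCi : IsPreconnected (j '' C i) := (hC i).image _ hjcont.continuousOn
    obtain ⟨_, ⟨c, hc, rfl⟩, hcN⟩ := hCi.exists_mem_frontier ⟨u, hu, rfl⟩ huN ⟨u', hu', rfl⟩
      fun h => hu'N (interior_subset (hNN' h))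
    obtain ⟨_, ⟨c', hc', rfl⟩, hcN'⟩ := hCi.exists_mem_frontier ⟨u, hu, rfl⟩
      (interior_subset (hNN' huN)) ⟨u', hu', rfl⟩ hu'N
    have h1 := hQR c c' hcN hcN' (hi c hc) (hi c' hc')
    have h2 := kobayashiDist_triangle E c (v i) c'
    rw [kobayashiDist_comm E c (v i)] at h2
    linarith [hCR i c hc, hCR i c' hc']
  rw [tendsto_nhds]
  intro U hU hyU
  cases y with
  | ofPoint q =>
    obtain ⟨N', hN', hqN', hN'U⟩ := exists_compact_subset hU.1 hyU
    obtain ⟨N, hN, hqN, hNN'⟩ := exists_compact_subset isOpen_interior hqN'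
    filter_upwards [hcross N N' hN hN' hNN', hv.eventually
      ((EndCompactification.isOpen_image_ofPoint isOpen_interior).mem_nhds ⟨q, hqN, rfl⟩)]
      with i hi hvi
    obtain ⟨q', hq', hqv⟩ := hvi
    obtain rfl : q' = j (v i) := EndCompactification.ofPoint_injective hqv
    exact hN'U (hi _ (hvC i) _ (hxC i) (interior_subset hq'))
  | ofEnd e =>
    obtain ⟨m, hm⟩ := hU.2 e hyU
    filter_upwards [hcross (K m) (K (m + 1)) (K.isCompact m) (K.isCompact _)
      (K.subset_interior_succ m),
      EndCompactification.eventually_notMem_of_tendsto_ofEnd hv (K.isCompact (m + 1)),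
      EndCompactification.eventually_mem_comp_of_tendsto_ofEnd hv m] with i hi hvi hvm
    have hCi : IsPreconnected (j '' C i) := (hC i).image _ hjcont.continuousOn
    -- If `C i` met `K m`, then `v i` would lie in `K (m + 1)`, which it has already left. So `x i`
    -- is in the same component of the complement of `K m` as `v i`.
    have hsub : j '' C i ⊆ (K m)ᶜ := by
      rintro _ ⟨u, hu, rfl⟩ huK
      exact hvi (hi u hu _ (hvC i) huK)
    refine hm (.inl ⟨j (x i), ?_, rfl⟩)
    obtain ⟨y₀, -, he⟩ := e.isComponent m
    rw [he] at hvm ⊢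
    rw [connectedComponentIn_eq hvm]
    exact hCi.subset_connectedComponentIn ⟨v i, hvC i, rfl⟩ hsub ⟨x i, hxC i, rfl⟩

end Shadowing

/-! ### Orbits and big horospheres -/

section Iteration

variable {E : Type*} [NormedAddCommGroup E] [NormedSpace ℂ E]

theorem kobayashiDist_iterate_le {M : Type*} [TopologicalSpace M] [ChartedSpace E M]
    [IsManifold 𝓘(ℂ, E) 1 M] [PreconnectedSpace M] {f : M → M}
    (hf : MDifferentiable 𝓘(ℂ, E) 𝓘(ℂ, E) f) (n : ℕ) (z w : M) :
    kobayashiDist E (f^[n] z) (f^[n] w) ≤ kobayashiDist E z w := by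
  induction n with
  | zero => exact le_rfl
  | succ n ih =>
    rw [Function.iterate_succ_apply', Function.iterate_succ_apply']
    exact (kobayashiDist_map_le hf _ _).trans ih

/-- A Wolff-type lemma: if `x` is a limit of the orbit of `p` along times at which the distance
from `p` is at least as large as ever before, then every point of the orbit is at bounded distance
from each big horosphere centred at `x`. -/
theorem exists_mem_bigHorosphere_of_orbit {X : Type*} [TopologicalSpace X] [ChartedSpace E X]
    [T2Space X] [LocallyCompactSpace X] {Ω : Opens X} [IsManifold 𝓘(ℂ, E) 1 Ω]
    [PreconnectedSpace Ω] {K : CompactExhaustion (closure (Ω : Set X))}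
    (hhyp : KobayashiHyperbolic E Ω) (hcomplete : KobayashiComplete E Ω) {f : Ω → Ω}
    (hf : MDifferentiable 𝓘(ℂ, E) 𝓘(ℂ, E) f) {p : Ω}
    (hesc : Tendsto (fun n : ℕ => kobayashiDist E p (f^[n] p)) atTop atTop)
    {φ : ℕ → ℕ} (hφ : Tendsto φ atTop atTop)
    (hrec : ∀ j, ∀ k ≤ φ j, kobayashiDist E p (f^[k] p) ≤ kobayashiDist E p (f^[φ j] p))
    {x : EndCompactification K}
    (hx : Tendsto (fun j => endInclusion Ω K (f^[φ j] p)) atTop (𝓝 x)) (R : ℝ) :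
    ∃ r, ∀ m : ℕ, ∃ v ∈ bigHorosphere E Ω K p x R, kobayashiDist E (f^[m] p) v ≤ r := by
  have hlocΩ : LocallyCompactSpace Ω := Ω.isOpen.locallyCompactSpace
  -- The 2 pays for the slack 1 in splitting and for an error 1 when `v j` is replaced by a cluster
  -- point. This r does not depend on m.
  obtain ⟨r, hr0, hrR⟩ : ∃ r : ℝ, 0 ≤ r ∧ -r + 2 < 1 / 2 * Real.log R :=
    ⟨max 0 (3 - 1 / 2 * Real.log R), le_max_left _ _, by
      linarith [le_max_right 0 (3 - 1 / 2 * Real.log R)]⟩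
  refine ⟨r, fun m => ?_⟩
  have hfar : ∀ᶠ j in atTop, m ≤ φ j ∧ r ≤ kobayashiDist E (f^[m] p) (f^[φ j] p) := by
    filter_upwards [hφ.eventually_ge_atTop m,
      (hesc.comp hφ).eventually_ge_atTop (kobayashiDist E p (f^[m] p) + r)] with j h1 h2
    have := kobayashiDist_triangle E p (f^[m] p) (f^[φ j] p)
    simp only [Function.comp_apply] at h2
    exact ⟨h1, by linarith⟩
  have hsplit : ∀ j, ∃ v : Ω, r ≤ kobayashiDist E (f^[m] p) (f^[φ j] p) →
      kobayashiDist E (f^[m] p) v ≤ r ∧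
      kobayashiDist E v (f^[φ j] p) < kobayashiDist E (f^[m] p) (f^[φ j] p) - r + 1 := by
    intro j
    by_cases h : r ≤ kobayashiDist E (f^[m] p) (f^[φ j] p)
    · obtain ⟨v, hv⟩ := kobayashiDist_split (f^[m] p) (f^[φ j] p) hr0 h one_pos
      exact ⟨v, fun _ => hv⟩
    -- A default value, used only for the finitely many j excluded by `hfar`.
    · exact ⟨p, fun h' => absurd h' h⟩
  choose v hv using hsplit
  obtain ⟨a, ha, hcl⟩ := (hcomplete.isCompact_closedBall hhyp (f^[m] p) r).exists_mapClusterPt_of_frequently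
    (f := v) (l := atTop) (hfar.mono fun j hj => (hv j hj.2).1).frequently
  refine ⟨a, ?_, ha⟩
  have hfreq : ∃ᶠ j in atTop,
      kobayashiDist E a (f^[φ j] p) - kobayashiDist E p (f^[φ j] p) ≤ -r + 2 := by
    refine ((hcl.frequently (eventually_kobayashiDist_lt (E := E) a one_pos)).and_eventually
      hfar).mono ?_
    rintro j ⟨h1, h2, h3⟩
    have h4 := kobayashiDist_triangle E a (v j) (f^[φ j] p)
    have h5 := (hv j h3).2
    -- Removing m iterations and then using the record property bounds the distance from fᵐp to the
    -- far iterate by the distance from p to it.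
    have h6 := kobayashiDist_iterate_le hf m p (f^[φ j - m] p)
    rw [← Function.iterate_add_apply, Nat.add_sub_cancel' h2] at h6
    have h7 := hrec j (φ j - m) (Nat.sub_le _ _)
    linarith
  have htend : Tendsto (fun j => f^[φ j] p) atTop (comap (endInclusion Ω K) (𝓝 x)) :=
    tendsto_comap_iff.2 hx
  refine lt_of_le_of_lt (liminf_le_of_frequently_le' (x := ((-r + 2 : ℝ) : EReal)) ?_)
    (EReal.coe_lt_coe_iff.2 hrR)
  exact htend.frequently (hfreq.mono fun j hj => EReal.coe_le_coe_iff.2 hj)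

end Iteration

/-! ### The Denjoy–Wolff dichotomy -/

theorem theorem1p5 {E : Type*} [NormedAddCommGroup E] [NormedSpace ℂ E] [FiniteDimensional ℂ E]
    {X : Type*} [TopologicalSpace X] [T2Space X] [SecondCountableTopology X]
    [ChartedSpace E X] [IsManifold 𝓘(ℂ, E) ω X]
    (Ω : Opens X) (hconn : IsConnected (Ω : Set X)) (hne : (Ω : Set X) ≠ univ)
    (K : CompactExhaustion (closure (Ω : Set X))) (hseq : SeqCompactSpace (EndCompactification K))
    (hhyp : KobayashiHyperbolic E Ω) (hcomplete : KobayashiComplete E Ω)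
    (hdiv : BoundaryDivergence E Ω)
    (p : Ω)
    (hsing : ∀ x ∈ endBoundary Ω K, ∃ y : EndCompactification K,
      (⋂ (R : ℝ) (_ : 0 < R), closure (endInclusion Ω K '' bigHorosphere E Ω K p x R)) = {y})
    (f : Ω → Ω) (hf : MDifferentiable 𝓘(ℂ, E) 𝓘(ℂ, E) f) :
    (∀ z : Ω, IsCompact (closure (range fun n : ℕ => f^[n] z))) ∨
    ∃ y ∈ endBoundary Ω K,
      Tendsto (fun n : ℕ => (endInclusion Ω K).comp ⟨f^[n], hf.continuous.iterate n⟩) atTop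
        (𝓝 (ContinuousMap.const Ω y)) := by
  have hproper : ProperSpace E := FiniteDimensional.proper ℂ E
  have hlocX : LocallyCompactSpace X := ChartedSpace.locallyCompactSpace E X
  have hlocΩ : LocallyCompactSpace Ω := Ω.isOpen.locallyCompactSpace
  have hman : IsManifold 𝓘(ℂ, E) 1 Ω := inferInstance
  have hpre : PreconnectedSpace Ω := Subtype.preconnectedSpace hconn.isPreconnected
  by_cases hb : ∃ C, ∃ᶠ n : ℕ in atTop, kobayashiDist E p (f^[n] p) ≤ C
  · left
    intro z
    obtain ⟨C, hC⟩ := hb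
    obtain ⟨C', hC'⟩ := hcomplete.bounded_orbit hhyp hf p hC
    refine (hcomplete.isCompact_closedBall hhyp p (C' + kobayashiDist E p z)).closure_of_subset ?_
    rintro _ ⟨n, rfl⟩
    exact (kobayashiDist_triangle E p (f^[n] p) _).trans
      (add_le_add (hC' n) (kobayashiDist_iterate_le hf n p z))
  right
  have hesc : Tendsto (fun n : ℕ => kobayashiDist E p (f^[n] p)) atTop atTop := by
    refine tendsto_atTop.2 fun C => ?_
    have : ¬ ∃ᶠ n : ℕ in atTop, kobayashiDist E p (f^[n] p) ≤ C := fun h => hb ⟨C, h⟩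
    exact (not_frequently.1 this).mono fun n hn => (not_le.1 hn).le
  have hleave : ∀ θ : ℕ → ℕ, Tendsto θ atTop atTop → ∀ Q : Set Ω, IsCompact Q →
      ∀ᶠ i in atTop, f^[θ i] p ∉ Q := by
    intro θ hθ Q hQ
    obtain ⟨B, hB⟩ := hQ.bddAbove_image (continuous_kobayashiDist_right E p).continuousOn
    filter_upwards [(hesc.comp hθ).eventually_gt_atTop B] with i hi hiQ
    exact hi.not_ge (hB ⟨_, hiQ, rfl⟩)
  -- Record times exist because the distances from p tend to infinity.
  obtain ⟨φ, hφ, hrec⟩ := extraction_of_frequently_atTop (frequently_high_scores hesc)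
  obtain ⟨x, ψ, hψ, hx⟩ :=
    SeqCompactSpace.tendsto_subseq fun j => endInclusion Ω K (f^[φ j] p)
  have hφψ : Tendsto (φ ∘ ψ) atTop atTop := (hφ.comp hψ).tendsto_atTop
  obtain ⟨y, hy⟩ := hsing x (mem_endBoundary_of_tendsto hx (hleave _ hφψ))
  have hnear := exists_mem_bigHorosphere_of_orbit hhyp hcomplete hf hesc hφψ
    (fun j k hk => hk.eq_or_lt.elim (fun h => h ▸ le_rfl) fun h => (hrec (ψ j) k h).le) hx
  have hconv : Tendsto (fun n : ℕ => endInclusion Ω K (f^[n] p)) atTop (𝓝 y) := by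
    refine tendsto_of_subseq_tendsto fun θ hθ => ?_
    obtain ⟨y', χ, hχ, hy'⟩ :=
      SeqCompactSpace.tendsto_subseq fun j => endInclusion Ω K (f^[θ j] p)
    have hy'b := mem_endBoundary_of_tendsto hy' (hleave _ (hθ.comp hχ.tendsto_atTop))
    suffices h : y' ∈ ({y} : Set (EndCompactification K)) by
      rw [← mem_singleton_iff.1 h]
      exact ⟨χ, hy'⟩
    rw [← hy]
    refine mem_iInter₂.2 fun R _ => ?_
    obtain ⟨r, hr⟩ := hnear R
    choose v hvH hvr using hr
    -- The horosphere points shadow the orbit, so they too converge to y', which puts y' in the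
    -- closure.
    have := tendsto_endBoundary_of_kobayashiDist_le hhyp hcomplete hdiv hy'b hy'
      (x := fun i => v (θ (χ i))) fun i => hvr _
    exact mem_closure_of_tendsto this (.of_forall fun i => ⟨_, hvH _, rfl⟩)
  have hyb := mem_endBoundary_of_tendsto hconv (hleave id tendsto_id)
  refine ⟨y, hyb, ContinuousMap.tendsto_nhds_compactOpen.2 fun Q hQ U hU hQU => ?_⟩
  by_contra hnot
  have hfreq : ∃ᶠ n : ℕ in atTop, ∃ z ∈ Q, endInclusion Ω K (f^[n] z) ∉ U := by
    refine (not_eventually.1 hnot).mono fun n hn => ?_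
    simpa [MapsTo] using hn
  obtain ⟨θ, hθ, hθU⟩ := extraction_of_frequently_atTop hfreq
  choose z hzQ hzU using hθU
  obtain ⟨B, hB⟩ := hQ.bddAbove_image (continuous_kobayashiDist_right E p).continuousOn
  -- The moving points `z i` stay within B of p, so their iterates shadow those of p.
  have htend := tendsto_endBoundary_of_kobayashiDist_le hhyp hcomplete hdiv hyb
    (hconv.comp hθ.tendsto_atTop) (x := fun i => f^[θ i] (z i))
    fun i => (kobayashiDist_iterate_le hf (θ i) p (z i)).trans (hB ⟨_, hzQ i, rfl⟩)
  -- The point `z 0` witnesses that Q is nonempty, hence that y lies in U.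
  obtain ⟨i, hi⟩ := (htend.eventually (hU.mem_nhds (hQU (hzQ 0)))).exists
  exact hzU i hi
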